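/- For a finite family of points in $\mathbb{Z}^E$ with convex hull $P\subset\mathbb{R}^E$, the Ehrhart polynomial of $P$ is the unique polynomial $\mathrm{ehr}_P\in\mathbb{Q}[t]$ with $\mathrm{ehr}_P(t)=|tP\cap\mathbb{Z}^E|$ for all integers $t\ge 0$. For a matroid $M$ on a finite ground set $E$, write $\mathrm{ehr}_M$ for the Ehrhart polynomial of its base polytope $\mathcal{P}_M=\mathrm{conv}\{\mathbf{e}_B : B \text{ a basis of } M\}\subset\mathbb{R}^E$, where $\mathbf{e}_B$ is the indicator vector of $B$. A hyperplane of a matroid of rank $r$ is a flat of rank $r-1$, and a matroid is paving if each of its circuits has cardinality at least its rank. Let $U_{r,n}$ denote the uniform matroid of rank $r$ on $\{1,\dots,n\}$. For a polynomial $p$ in $t$ and an integer $k\ge 0$, put $\binom{p}{k}=\frac{1}{k!}\,p(p-1)\cdots(p-k+1)$. Theorem. Let $M$ be a paving matroid of rank $r$ on a ground set of $n$ elements, and for $r\le s\le n-1$ let $\mathcal{H}_s$ be the set of hyperplanes of $M$ of cardinality $s$. Then the polynomials $\mathrm{ehr}_M$ and $\mathrm{ehr}_{U_{r,n}}$ exist,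 and as polynomials in $t$ $$\mathrm{ehr}_M(t)=\mathrm{ehr}_{U_{r,n}}(t)-\sum_{s=r}^{n-1}|\mathcal{H}_s|\,\frac{n-s}{(n-1)!}\binom{t-1+n-s}{n-s}\,\tilde\phi_{r,s,n}(t),$$ where $$\tilde\phi_{r,s,n}(t)=\sum_{i=0}^{s-r}(-1)^i\binom{s}{i}\sum_{\ell=0}^{s-1}(n-2-\ell)!\,\ell!\,\binom{s-2-\ell-i+t(s-r-i+1)}{s-1-\ell}\binom{s-1-i+t(s-r-i)}{\ell}.$$ (If $r=0$ then $M$ has no hyperplanes and the sum over $s$ is zero.) -/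

import Mathlib

open scoped Pointwise Nat Polynomial

noncomputable section

namespace PavingEhrhart

/-- The uniform matroid `U_r(α)` on the ground set `α`: a set is independent iff it has at most
`r` elements. (For `r ≤ |α|` the bases are the `r`-subsets, see `uniform_isBase_iff`.) -/
def uniform (α : Type*) (r : ℕ) : Matroid α :=
  (IndepMatroid.ofBddAugment (E := Set.univ) (Indep := fun I : Set α => I.encard ≤ r)
    (by simp)
    (fun _ _ hJ hIJ => (Set.encard_le_encard hIJ).trans hJ)
    (by
      intro I J hI hJ hIJ
      obtain ⟨e, heJ, heI⟩ : ∃ e ∈ J, e ∉ I := by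
        by_contra! h
        exact absurd (Set.encard_le_encard h) (not_le.mpr hIJ)
      refine ⟨e, heJ, heI, ?_⟩
      rw [Set.encard_insert_of_notMem heI]
      exact (Order.add_one_le_of_lt hIJ).trans hJ)
    ⟨r, fun _ h => h⟩
    (fun _ _ => Set.subset_univ _)).matroid

@[simp] theorem uniform_ground (α : Type*) (r : ℕ) : (uniform α r).E = Set.univ := rfl

theorem uniform_indep_iff {α : Type*} {r : ℕ} {I : Set α} :
    (uniform α r).Indep I ↔ I.encard ≤ r := Iff.rfl

theorem uniform_isBase_iff {α : Type*} [Fintype α] {r : ℕ} (hr : r ≤ Fintype.card α)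
    {B : Set α} : (uniform α r).IsBase B ↔ B.encard = r := by
  rw [Matroid.isBase_iff_maximal_indep]
  constructor
  · intro h
    have hB : B.encard ≤ r := h.prop
    by_contra hne
    have hlt : B.encard < r := lt_of_le_of_ne hB hne
    obtain ⟨e, he⟩ : ∃ e, e ∉ B := by
      by_contra! hall
      rw [Set.eq_univ_of_forall hall, Set.encard_univ, ENat.card_eq_coe_fintype_card] at hlt
      exact absurd hr (not_le.mpr (by exact_mod_cast hlt))
    have hi : (uniform α r).Indep (insert e B) := by
      rw [uniform_indep_iff, Set.encard_insert_of_notMem he]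
      exact Order.add_one_le_of_lt hlt
    exact he (h.le_of_ge hi (Set.subset_insert e B) (Set.mem_insert e B))
  · intro h
    refine ⟨h.le, fun J hJ hBJ => ?_⟩
    have hJ' : J.encard ≤ r := hJ
    exact ((Set.toFinite B).eq_of_subset_of_encard_le hBJ (hJ'.trans h.ge)).ge

/-- A matroid is paving if every circuit has cardinality at least the rank of the matroid. -/
def IsPaving {α : Type*} (M : Matroid α) : Prop :=
  ∀ C : Set α, M.IsCircuit C → M.eRank ≤ C.encard

/-- A hyperplane of a matroid of rank `r` is a flat of rank `r - 1`
(so a matroid of rank `0` has no hyperplanes). -/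
def IsHyperplane {α : Type*} (M : Matroid α) (H : Set α) : Prop :=
  M.IsFlat H ∧ M.eRk H + 1 = M.eRank

/-- The number of hyperplanes of `M` that have exactly `s` elements. -/
def numHyperplanes {α : Type*} (M : Matroid α) (s : ℕ) : ℕ :=
  {H : Set α | IsHyperplane M H ∧ H.encard = s}.ncard

/-- The base polytope of a matroid: the convex hull of the indicator vectors of its bases. -/
def basePolytope {α : Type*} (M : Matroid α) : Set (α → ℝ) :=
  convexHull ℝ ((fun B : Set α => B.indicator (fun _ => (1 : ℝ))) '' {B | M.IsBase B})

/-- The Ehrhart function: the number of lattice points in the dilate `t P`. -/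
def ehrhart {ι : Type*} (P : Set (ι → ℝ)) (t : ℕ) : ℕ :=
  {x : ι → ℤ | (fun i => (x i : ℝ)) ∈ (t : ℝ) • P}.ncard

/-- `p` is the Ehrhart polynomial of `P`: it agrees with the Ehrhart function on `ℕ`. -/
def IsEhrhartPolynomial {ι : Type*} (P : Set (ι → ℝ)) (p : ℚ[X]) : Prop :=
  ∀ t : ℕ, p.eval (t : ℚ) = (ehrhart P t : ℚ)

theorem IsEhrhartPolynomial.unique {ι : Type*} {P : Set (ι → ℝ)} {p q : ℚ[X]}
    (hp : IsEhrhartPolynomial P p) (hq : IsEhrhartPolynomial P q) : p = q := by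
  refine Polynomial.eq_of_infinite_eval_eq p q ?_
  refine (Set.infinite_range_of_injective (Nat.cast_injective (R := ℚ))).mono ?_
  rintro _ ⟨t, rfl⟩
  exact (hp t).trans (hq t).symm

/-- The polynomial binomial coefficient `p (p - 1) ⋯ (p - k + 1) / k!`. -/
def polyChoose (p : ℚ[X]) (k : ℕ) : ℚ[X] :=
  Polynomial.C ((k ! : ℚ)⁻¹) * ∏ j ∈ Finset.range k, (p - (j : ℚ[X]))

/-- The polynomial `φ̃_{r,s,n}(t)`, with `t` the variable `X`; it is used for `1 ≤ r ≤ s < n`,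
where none of the natural-number subtractions truncates. -/
def phiTilde (r s n : ℕ) : ℚ[X] :=
  ∑ i ∈ Finset.range (s - r + 1), (-1) ^ i * ((s.choose i : ℕ) : ℚ[X]) *
    ∑ l ∈ Finset.range s, (((n - 2 - l)! * l ! : ℕ) : ℚ[X]) *
      polyChoose ((s : ℚ[X]) - 2 - (l : ℚ[X]) - (i : ℚ[X]) + Polynomial.X * ((s : ℚ[X]) - (r : ℚ[X]) - (i : ℚ[X]) + 1))
        (s - 1 - l) *
      polyChoose ((s : ℚ[X]) - 1 - (i : ℚ[X]) + Polynomial.X * ((s : ℚ[X]) - (r : ℚ[X]) - (i : ℚ[X]))) l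

end PavingEhrhart

end

/-! Write x(S) for the sum of the coordinates of x over S. The base polytope of a paving matroid of
rank r ≥ 1 is the slice x(E) = r of the unit cube, cut by x(H) ≤ r - 1 for every hyperplane H. The
inequalities come from rank; conversely, a greedy basis beats any point satisfying them in every
linear functional, so no functional separates such a point from the polytope
(`mem_basePolytope_iff`).

Two distinct hyperplanes share at most r - 2 elements, so a lattice point of the t-dilated slice
violates at most one of the inequalities. Hence the Ehrhart function is the count for the slice,
which is the base polytope of the uniform matroid, minus one term `cutCount` per hyperplane
(`ehrhart_add_sum_cutCount`). That term vanishes when |H| < r, and otherwise depends only on |H|.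

To evaluate it, let y < t be the coordinate sum outside H. There the upper bound t is automatic;
inside H, the reflection x ↦ t - x and inclusion-exclusion give an alternating sum of binomials. The
sum over y is closed by a telescoping identity (`sum_choose_mul_ratChoose`), which produces φ̃. -/

namespace PavingEhrhart

/-! ### Binomial coefficients and a telescoping sum -/

/-- The binomial coefficient `x (x - 1) ⋯ (x - k + 1) / k!` of a rational number `x`. -/
def ratChoose (x : ℚ) (k : ℕ) : ℚ := (k ! : ℚ)⁻¹ * ∏ j ∈ Finset.range k, (x - j)

theorem eval_polyChoose (p : ℚ[X]) (k : ℕ) (x : ℚ) :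
    (polyChoose p k).eval x = ratChoose (p.eval x) k := by
  simp [polyChoose, ratChoose, Polynomial.eval_prod]

@[simp] theorem ratChoose_zero (x : ℚ) : ratChoose x 0 = 1 := by simp [ratChoose]

theorem ratChoose_succ (x : ℚ) (k : ℕ) :
    (k + 1) * ratChoose x (k + 1) = (x - k) * ratChoose x k := by
  have h : (k ! : ℚ) ≠ 0 := by positivity
  have h' : (k + 1 : ℚ) ≠ 0 := by positivity
  simp only [ratChoose, Finset.prod_range_succ, Nat.factorial_succ, Nat.cast_mul, Nat.cast_succ]
  field_simp

theorem ratChoose_succ' (x : ℚ) (k : ℕ) :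
    (k + 1) * ratChoose x (k + 1) = x * ratChoose (x - 1) k := by
  have h : (k ! : ℚ) ≠ 0 := by positivity
  have h' : (k + 1 : ℚ) ≠ 0 := by positivity
  simp only [ratChoose, Finset.prod_range_succ', Nat.factorial_succ, Nat.cast_mul, Nat.cast_succ,
    Nat.cast_zero, sub_zero]
  have : ∀ j : ℕ, x - ((j : ℚ) + 1) = x - 1 - j := fun j => by ring
  simp only [this]
  field_simp

theorem ratChoose_pascal (x : ℚ) (k : ℕ) :
    ratChoose x (k + 1) = ratChoose (x - 1) k + ratChoose (x - 1) (k + 1) := by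
  have h' : (k + 1 : ℚ) ≠ 0 := by positivity
  have h1 := ratChoose_succ' x k
  have h2 := ratChoose_succ (x - 1) k
  apply mul_left_cancel₀ h'
  linear_combination h1 - h2

theorem ratChoose_natCast (N k : ℕ) : ratChoose (N : ℚ) k = N.choose k := by
  have h : (k ! : ℚ) ≠ 0 := by positivity
  rw [ratChoose, inv_mul_eq_iff_eq_mul₀ h, ← descPochhammer_eval_eq_prod_range,
    descPochhammer_eval_eq_descFactorial, Nat.descFactorial_eq_factorial_mul_choose, Nat.cast_mul]

/-- The inner sum of `φ̃`, with a shifted parametrization. -/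
def innerSum (p k : ℕ) (a t : ℚ) : ℚ :=
  ∑ l ∈ Finset.range (k + 1), ((p + k - l)! * l ! : ℕ) * ratChoose (a + t - 1 - l) (k - l) *
    ratChoose a l

/-- The difference telescopes termwise in l, with certificate `W`; only `W 0` survives, and it is
the right-hand side. Each termwise identity reduces to absorption and Pascal's rule. -/
theorem innerSum_step (p k : ℕ) (a t : ℚ) :
    (t + p + 1) * innerSum p k a (t + 1) - t * innerSum p k a t
      = (p + 1 + k)! * ratChoose (a + t) k := by
  -- The cutoff matters: with truncated `k - l`, the bare formula need not vanish at `l = k + 1`.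
  set W : ℕ → ℚ := fun l => if l ≤ k then
    ((p + 1 + k - l)! * l ! : ℕ) * ratChoose (a + t - l) (k - l) * ratChoose a l else 0 with hW
  have key : ∀ l ∈ Finset.range (k + 1),
      (t + p + 1) * (((p + k - l)! * l ! : ℕ) * ratChoose (a + (t + 1) - 1 - l) (k - l) *
        ratChoose a l) - t * (((p + k - l)! * l ! : ℕ) * ratChoose (a + t - 1 - l) (k - l) *
        ratChoose a l) = W l - W (l + 1) := by
    intro l hl
    obtain ⟨j, rfl⟩ := Nat.exists_eq_add_of_le (Nat.lt_succ_iff.mp (Finset.mem_range.mp hl))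
    have e1 : p + (l + j) - l = p + j := by omega
    have e2 : p + 1 + (l + j) - l = p + j + 1 := by omega
    have e3 : p + 1 + (l + j) - (l + 1) = p + j := by omega
    have e4 : l + j - l = j := by omega
    have e5 : a + (t + 1) - 1 - l = a + t - l := by ring
    have e6 : a + t - 1 - (l : ℚ) = a + t - l - 1 := by ring
    have e7 : a + t - ((l : ℚ) + 1) = a + t - l - 1 := by ring
    simp only [hW, e1, e2, e3, e4, e5, e6, e7, Nat.factorial_succ, Nat.le_add_right, if_true,
      Nat.cast_mul, Nat.cast_succ, Nat.cast_add]
    have h0 := ratChoose_succ a l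
    cases j with
    | zero => simp; ring
    | succ j =>
      have e8 : l + 1 ≤ l + (j + 1) := by omega
      have e9 : l + (j + 1) - (l + 1) = j := by omega
      simp only [e8, e9, if_true, Nat.cast_succ]
      have h1 := ratChoose_succ' (a + t - l) j
      have h2 := ratChoose_pascal (a + t - l) j
      linear_combination (((p + (j + 1))! : ℚ) * (l ! : ℚ)) *
        (ratChoose (a + t - l - 1) j * h0 - ratChoose a l * h1 + t * ratChoose a l * h2)
  rw [innerSum, innerSum, Finset.mul_sum, Finset.mul_sum, ← Finset.sum_sub_distrib,
    Finset.sum_congr rfl key, Finset.sum_range_sub']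
  simp [hW]

/-- Induction on `t` with `a` fixed: `innerSum_step` is exactly the increment of the right-hand
side. Once proved, `a` may be specialized to a value depending on `t`. -/
theorem sum_choose_mul_ratChoose (p k : ℕ) (a : ℚ) (t : ℕ) :
    ∑ y ∈ Finset.range t, ((y + p).choose p : ℚ) * ratChoose (a + y) k =
      (p + 1) / (p + 1 + k)! * ratChoose (t + p) (p + 1) * innerSum p k a t := by
  have hf : ((p + 1 + k)! : ℚ) ≠ 0 := by positivity
  induction t with
  | zero =>
    have : ratChoose p (p + 1) = 0 := by
      rw [ratChoose_natCast]; simp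
    simp [this]
  | succ t ih =>
    rw [Finset.sum_range_succ, ih]
    have h := innerSum_step p k a t
    have h1 := ratChoose_succ (t + p) p
    have h2 := ratChoose_succ' ((t : ℚ) + 1 + p) p
    have e : (t : ℚ) + 1 + p - 1 = t + p := by ring
    have h3 := ratChoose_natCast (t + p) p
    rw [e] at h2
    push_cast at h3 ⊢
    rw [← h3]
    field_simp
    linear_combination innerSum p k a t * h1 - innerSum p k a (t + 1) * h2 - ratChoose (t + p) p * h

end PavingEhrhart

/-! ### Lattice points in cubes and in cut-off pieces -/

namespace PavingEhrhart

open Classical in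
/-- The number of lattice points of the cube `[0, t]^β` with coordinate sum `N`. -/
noncomputable def boxCount (β : Type*) [Fintype β] (t N : ℕ) : ℕ :=
  (Finset.univ.filter fun x : β → Fin (t + 1) => ∑ i, (x i : ℕ) = N).card

variable {β : Type*} [Fintype β]

open PowerSeries in
theorem boxCount_eq_coeff (t N : ℕ) :
    (boxCount β t N : ℤ) =
      coeff N ((∑ j ∈ Finset.range (t + 1), (X : ℤ⟦X⟧) ^ j) ^ Fintype.card β) := by
  classical
  rw [← Fin.sum_univ_eq_sum_range (fun j => (X : ℤ⟦X⟧) ^ j), ← Finset.card_univ,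
    ← Finset.prod_const, Finset.prod_univ_sum, map_sum, Fintype.piFinset_univ]
  simp only [Finset.prod_pow_eq_pow_sum, coeff_X_pow]
  rw [boxCount, Finset.card_filter]
  push_cast
  exact Finset.sum_congr rfl fun x _ => by simp only [eq_comm]

open PowerSeries in
-- Expand the generating function ((1 - X^(t+1)) / (1 - X))^(k+1); the index i counts coordinates
-- forced above t.
theorem boxCount_eq_sum (t N k : ℕ) (hk : Fintype.card β = k + 1) :
    (boxCount β t N : ℤ) = ∑ i ∈ Finset.range (k + 2), (-1) ^ i * ((k + 1).choose i : ℤ) *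
      if i * (t + 1) ≤ N then ((k + (N - i * (t + 1))).choose k : ℤ) else 0 := by
  have h1 : ((1 : ℤ⟦X⟧) - X) ^ (k + 1) * (mk 1) ^ (k + 1) = 1 := by
    rw [← mul_pow, mul_comm, mk_one_mul_one_sub_eq_one, one_pow]
  have h2 : (∑ j ∈ Finset.range (t + 1), (X : ℤ⟦X⟧) ^ j) ^ (k + 1) =
      (1 - X ^ (t + 1)) ^ (k + 1) * (mk 1) ^ (k + 1) := by
    rw [← mul_neg_geom_sum, mul_pow, mul_right_comm, h1, one_mul]
  rw [boxCount_eq_coeff, hk, h2, sub_eq_neg_add, add_pow, Finset.sum_mul, map_sum]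
  refine Finset.sum_congr rfl fun i _ => ?_
  have h3 : (-(X : ℤ⟦X⟧) ^ (t + 1)) ^ i * 1 ^ (k + 1 - i) * ((k + 1).choose i : ℤ⟦X⟧) *
      (mk 1) ^ (k + 1) = C ((-1) ^ i * ((k + 1).choose i : ℤ)) *
        (X ^ (i * (t + 1)) * (mk 1) ^ (k + 1)) := by
    rw [neg_pow, ← pow_mul, mul_comm (t + 1) i]
    simp
    ring
  rw [h3, coeff_C_mul, coeff_X_pow_mul', mk_one_pow_eq_mk_choose_add, coeff_mk]

theorem boxCount_of_le {t N k : ℕ} (hk : Fintype.card β = k + 1) (h : N ≤ t) :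
    boxCount β t N = (N + k).choose k := by
  have := boxCount_eq_sum t N k hk
  rw [Finset.sum_eq_single_of_mem 0 (by simp)] at this
  · simp at this
    rw [add_comm N k]
    exact_mod_cast this
  · intro i _ hi
    rw [if_neg, mul_zero]
    have : 1 * (t + 1) ≤ i * (t + 1) := Nat.mul_le_mul_right _ (Nat.pos_of_ne_zero hi)
    omega

/-- Writing the total as `t * c + y` with `y ≤ t` makes the range of i independent of t and y, and
turns each summand into a polynomial expression, as a closed Ehrhart formula requires. -/
theorem boxCount_eq_ratChoose {t y c k : ℕ} (hk : Fintype.card β = k + 1) (hc : c ≤ k)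
    (hy : y ≤ t) :
    (boxCount β t (t * c + y) : ℚ) = ∑ i ∈ Finset.range (c + 1),
      (-1) ^ i * ((k + 1).choose i : ℚ) * ratChoose (k - i + t * (c - i) + y) k := by
  have h := congrArg (Int.cast (R := ℚ)) (boxCount_eq_sum t (t * c + y) k hk)
  push_cast at h
  rw [h]
  symm
  have hsub : Finset.range (c + 1) ⊆ Finset.range (k + 2) := by
    intro i; simp only [Finset.mem_range]; omega
  apply Finset.sum_subset_zero_on_sdiff hsub
  · intro i hi
    have : c + 1 ≤ i := by simpa using (Finset.mem_sdiff.mp hi).2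
    rw [if_neg, mul_zero]
    have : (c + 1) * (t + 1) ≤ i * (t + 1) := Nat.mul_le_mul_right _ this
    nlinarith
  · intro i hi
    obtain ⟨d, rfl⟩ := Nat.exists_eq_add_of_le (Nat.lt_succ_iff.mp (Finset.mem_range.mp hi))
    obtain ⟨e, rfl⟩ := Nat.exists_eq_add_of_le hc
    congr 1
    have e1 : (((i + d + e : ℕ) : ℚ) - i + t * (((i + d : ℕ) : ℚ) - i) + y)
        = ((d + e + t * d + y : ℕ) : ℚ) := by push_cast; ring
    rw [e1, ratChoose_natCast]
    have e2 : t * (i + d) = i * t + t * d := by ring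
    have e3 : i * (t + 1) = i * t + i := by ring
    split_ifs with h
    · congr 2
      omega
    -- The excluded terms vanish by themselves: the upper entry is a natural number below `k`.
    · rw [Nat.choose_eq_zero_of_lt (by omega), Nat.cast_zero]

theorem boxCount_compl (t N N' : ℕ) (h : N + N' = t * Fintype.card β) :
    boxCount β t N = boxCount β t N' := by
  classical
  unfold boxCount
  refine Finset.card_bij' (fun x _ i => (x i).rev) (fun x _ i => (x i).rev) ?_ ?_ ?_ ?_
  all_goals simp only [Finset.mem_filter, Finset.mem_univ, true_and, Fin.rev_rev, implies_true]
  all_goals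
    intro x hx
    have : ∑ i, (x i : ℕ) + ∑ i, ((x i).rev : ℕ) = t * Fintype.card β := by
      rw [← Finset.sum_add_distrib, Finset.sum_congr rfl (g := fun _ => t)]
      · simp [mul_comm]
      · intro i _
        have := (x i).2
        rw [Fin.val_rev]
        omega
    omega

theorem boxCount_congr {γ : Type*} [Fintype γ] (e : β ≃ γ) (t N : ℕ) :
    boxCount β t N = boxCount γ t N := by
  classical
  have h : Fintype.card β = Fintype.card γ := Fintype.card_congr e
  exact_mod_cast (boxCount_eq_coeff (β := β) t N).trans (h ▸ (boxCount_eq_coeff (β := γ) t N).symm)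

open Classical in
/-- The number of lattice points of `[0, t]^β` with coordinate sum `t r` violating the inequality
`x(H) ≤ t (r - 1)`. -/
noncomputable def cutCount (H : Finset β) (t r : ℕ) : ℕ :=
  (Finset.univ.filter fun x : β → Fin (t + 1) =>
    ∑ i, (x i : ℕ) = t * r ∧ t * (r - 1) < ∑ i ∈ H, (x i : ℕ)).card

/-- Here y is the coordinate sum outside `H`; violating the inequality strictly means exactly y < t.
-/
theorem cutCount_eq_sum [DecidableEq β] (H : Finset β) (t r : ℕ) (hr : 1 ≤ r) :
    cutCount H t r = ∑ y ∈ Finset.range t,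
      boxCount {i // i ∈ H} t (t * r - y) * boxCount {i // i ∉ H} t y := by
  obtain ⟨q, rfl⟩ := Nat.exists_eq_add_of_le' hr
  set e := Equiv.piEquivPiSubtypeProd (fun i => i ∈ H) (fun _ : β => Fin (t + 1)) with he
  have hsumH : ∀ x : β → Fin (t + 1), ∑ i ∈ H, (x i : ℕ) = ∑ i, ((e x).1 i : ℕ) := fun x =>
    Finset.sum_subtype H (fun _ => Iff.rfl) _
  have hsum : ∀ x : β → Fin (t + 1), ∑ i, (x i : ℕ) =
      ∑ i, ((e x).1 i : ℕ) + ∑ i, ((e x).2 i : ℕ) := fun x => by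
    rw [← hsumH, ← Finset.sum_add_sum_compl H]
    congr 1
    exact Finset.sum_subtype Hᶜ (fun _ => Finset.mem_compl) _
  have hmap : (Finset.univ.filter fun x : β → Fin (t + 1) =>
      ∑ i, (x i : ℕ) = t * (q + 1) ∧ t * (q + 1 - 1) < ∑ i ∈ H, (x i : ℕ)).map e.toEmbedding =
      (Finset.range t).biUnion fun y =>
        (Finset.univ.filter fun z : {i // i ∈ H} → Fin (t + 1) =>
          ∑ i, (z i : ℕ) = t * (q + 1) - y) ×ˢ
        (Finset.univ.filter fun z : {i // i ∉ H} → Fin (t + 1) => ∑ i, (z i : ℕ) = y) := by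
    ext z
    obtain ⟨x, rfl⟩ := e.surjective z
    have hm : t * (q + 1) = t * q + t := by ring
    simp only [Finset.mem_map_equiv, Equiv.symm_apply_apply, Finset.mem_filter, Finset.mem_univ,
      true_and, Finset.mem_biUnion, Finset.mem_range, Finset.mem_product, hsum, hsumH, hm,
      Nat.add_sub_cancel]
    constructor
    · rintro ⟨h1, h2⟩
      exact ⟨_, by omega, by omega, rfl⟩
    · rintro ⟨y, h1, h2, h3⟩
      omega
  have hcard := congrArg Finset.card hmap
  rw [Finset.card_map, Finset.card_biUnion] at hcard
  · refine Eq.trans (by unfold cutCount; congr!) (hcard.trans (Finset.sum_congr rfl fun y _ =>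
      (Finset.card_product _ _).trans (by unfold boxCount; congr!)))
  · intro y _ y' _ hyy'
    rw [Function.onFun, Finset.disjoint_left]
    intro z hz hz'
    simp only [Finset.mem_product, Finset.mem_filter] at hz hz'
    exact hyy' (hz.2.2.symm.trans hz'.2.2)

end PavingEhrhart

/-! ### Hyperplanes and the base polytope of a paving matroid -/

namespace PavingEhrhart

variable {α : Type*}

theorem IsPaving.indep {M : Matroid α} (hM : IsPaving M) (hE : M.E = Set.univ) {r : ℕ}
    (hr : M.eRank = (r : ℕ∞)) {B : Set α} (hB : B.encard < r) : M.Indep B := by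
  by_contra h
  obtain ⟨C, hCB, hC⟩ := Matroid.Dep.exists_isCircuit_subset
    (Matroid.dep_iff.mpr ⟨h, hE ▸ Set.subset_univ B⟩)
  exact absurd ((hM C hC).trans (Set.encard_le_encard hCB)) (by rw [hr]; exact not_le.mpr hB)

theorem IsHyperplane.eRk_eq {M : Matroid α} {q : ℕ} (hr : M.eRank = ((q + 1 : ℕ) : ℕ∞))
    {H : Set α} (hH : IsHyperplane M H) : M.eRk H = q := by
  have := hH.2
  rw [hr, Nat.cast_succ] at this
  exact (ENat.add_left_injective_of_ne_top (by simp)) this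

variable [Fintype α]

theorem IsPaving.closure_eq {M : Matroid α} (hM : IsPaving M) (hE : M.E = Set.univ) {q : ℕ}
    (hr : M.eRank = ((q + 1 : ℕ) : ℕ∞)) {B H : Finset α} (hH : IsHyperplane M (H : Set α))
    (hB : B.card = q) (hBH : B ⊆ H) : M.closure (B : Set α) = (H : Set α) := by
  have hBc : (B : Set α).encard = q := by rw [Set.encard_coe_eq_coe_finsetCard, hB]
  have hBi : M.Indep (B : Set α) := hM.indep hE hr (by rw [hBc]; exact_mod_cast Nat.lt_succ_self q)
  have hHr := hH.eRk_eq hr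
  have hb : M.IsBasis (B : Set α) (H : Set α) :=
    hBi.isBasis_of_eRk_ge (Set.toFinite _) (by exact_mod_cast hBH)
      (by rw [hHr, hBi.eRk_eq_encard, hBc]) (hE ▸ Set.subset_univ _)
  rw [hb.closure_eq_closure, hH.1.closure]

/-- A q-set is independent, hence spans any hyperplane containing it, so it cannot lie in two of
them. -/
theorem IsPaving.card_inter_lt {M : Matroid α} [DecidableEq α] (hM : IsPaving M)
    (hE : M.E = Set.univ) {q : ℕ} (hr : M.eRank = ((q + 1 : ℕ) : ℕ∞)) {H H' : Finset α}
    (hH : IsHyperplane M (H : Set α)) (hH' : IsHyperplane M (H' : Set α)) (hne : H ≠ H') :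
    (H ∩ H').card < q := by
  by_contra! h
  obtain ⟨B, hB, hBc⟩ := Finset.exists_subset_card_eq h
  apply hne
  have h1 := hM.closure_eq hE hr hH hBc (hB.trans Finset.inter_subset_left)
  have h2 := hM.closure_eq hE hr hH' hBc (hB.trans Finset.inter_subset_right)
  exact_mod_cast h1.symm.trans h2

theorem exists_top_finset [Nonempty α] (w : α → ℝ) (k : ℕ) (hk : k ≤ Fintype.card α) :
    ∃ B : Finset α, B.card = k ∧ ∃ c, (∀ i ∈ B, c ≤ w i) ∧ ∀ i ∉ B, w i ≤ c := by
  classical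
  induction k with
  | zero =>
    obtain ⟨j, hj⟩ := Finite.exists_max w
    exact ⟨∅, rfl, w j, by simp, fun i _ => hj i⟩
  | succ k ih =>
    obtain ⟨B, hB, c, h1, h2⟩ := ih (by omega)
    have hne : (Bᶜ).Nonempty := by
      rw [← Finset.card_pos, Finset.card_compl]; omega
    obtain ⟨j, hj, hjmax⟩ := Finset.exists_max_image Bᶜ w hne
    rw [Finset.mem_compl] at hj
    refine ⟨insert j B, by rw [Finset.card_insert_of_notMem hj, hB], w j, ?_, ?_⟩
    · intro i hi
      rcases Finset.mem_insert.mp hi with rfl | hi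
      · exact le_rfl
      · exact (h2 j hj).trans (h1 i hi)
    · intro i hi
      rw [Finset.mem_insert, not_or] at hi
      exact hjmax i (Finset.mem_compl.mpr hi.2)

/-- Some basis has weight at least that of any point satisfying the defining inequalities of the
base polytope of a paving matroid. -/
theorem IsPaving.exists_isBase_weight {M : Matroid α} (hM : IsPaving M) (hE : M.E = Set.univ)
    {q : ℕ} (hr : M.eRank = ((q + 1 : ℕ) : ℕ∞)) (x w : α → ℝ) (h0 : ∀ i, 0 ≤ x i)
    (h1 : ∀ i, x i ≤ 1) (hsum : ∑ i, x i = q + 1)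
    (hH : ∀ H : Finset α, IsHyperplane M (H : Set α) → ∑ i ∈ H, x i ≤ q) :
    ∃ B : Finset α, M.IsBase (B : Set α) ∧ ∑ i, x i * w i ≤ ∑ i ∈ B, w i := by
  classical
  have hcard : q + 1 ≤ Fintype.card α := by
    have := M.eRank_le_encard_ground
    rw [hr, hE, Set.encard_univ, ENat.card_eq_coe_fintype_card] at this
    exact_mod_cast this
  have : Nonempty α := Fintype.card_pos_iff.mp (by omega)
  -- Greedy choice: the q heaviest elements are independent because the matroid is paving; the basis
  -- adds the heaviest element outside their closure `H`.
  obtain ⟨B, hBc, c, hc1, hc2⟩ := exists_top_finset w q (by omega)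
  have hBe : (B : Set α).encard = q := by rw [Set.encard_coe_eq_coe_finsetCard, hBc]
  have hBi : M.Indep (B : Set α) := hM.indep hE hr (by rw [hBe]; exact_mod_cast Nat.lt_succ_self q)
  set H : Finset α := (M.closure (B : Set α)).toFinset with hHdef
  have hHcl : (H : Set α) = M.closure (B : Set α) := Set.coe_toFinset _
  have hHr : M.eRk (H : Set α) = q := by rw [hHcl, Matroid.eRk_closure_eq, hBi.eRk_eq_encard, hBe]
  have hHyp : IsHyperplane M (H : Set α) :=
    ⟨hHcl ▸ M.isFlat_closure _, by rw [hHr, hr]; simp⟩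
  have hBH : B ⊆ H := by
    have := M.subset_closure (B : Set α) (hE ▸ Set.subset_univ _)
    rw [← hHcl] at this
    exact_mod_cast this
  have hne : (Hᶜ).Nonempty := by
    rw [Finset.nonempty_iff_ne_empty, Ne, Finset.compl_eq_empty_iff]
    intro h
    have h2 : M.eRk (H : Set α) = M.eRank := by rw [h, Finset.coe_univ, ← hE, Matroid.eRk_ground]
    rw [hHr, hr] at h2
    have : q = q + 1 := by exact_mod_cast h2
    omega
  obtain ⟨e, he, hemax⟩ := Finset.exists_max_image Hᶜ w hne
  rw [Finset.mem_compl] at he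
  have heB : e ∉ B := fun h => he (hBH h)
  refine ⟨insert e B, ?_, ?_⟩
  · have hi : M.Indep ((insert e B : Finset α) : Set α) := by
      rw [Finset.coe_insert, hBi.insert_indep_iff]
      left
      rw [← hHcl, hE]
      exact ⟨Set.mem_univ _, by exact_mod_cast he⟩
    refine hi.isBase_of_eRk_ge (Set.toFinite _) ?_
    rw [hi.eRk_eq_encard, hr, Set.encard_coe_eq_coe_finsetCard, Finset.card_insert_of_notMem heB,
      hBc]
  · rw [Finset.sum_insert heB]
    have hce : w e ≤ c := hc2 e heB
    have hsplit : ∑ i ∈ H, x i + ∑ i ∈ Hᶜ, x i = q + 1 := by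
      rw [Finset.sum_add_sum_compl, hsum]
    -- Weights are compared after subtracting the threshold `c`. Summing gives at most the excess of
    -- `B` plus `(w e - c) * x(Hᶜ)`; since `w e ≤ c` and `x(Hᶜ) ≥ 1`, the last term is at most `w e
    -- - c`.
    have key : ∀ i, x i * (w i - c) ≤
        (if i ∈ B then w i - c else 0) + (if i ∈ Hᶜ then (w e - c) * x i else 0) := by
      intro i
      by_cases hiB : i ∈ B
      · have : i ∉ Hᶜ := by simpa using hBH hiB
        rw [if_pos hiB, if_neg this]
        nlinarith [h0 i, h1 i, hc1 i hiB]
      · rw [if_neg hiB, zero_add]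
        split_ifs with hiH
        · nlinarith [h0 i, hemax i hiH]
        · nlinarith [h0 i, hc2 i hiB]
    have h2 := Finset.sum_le_sum fun i (_ : i ∈ Finset.univ) => key i
    rw [Finset.sum_add_distrib, Finset.sum_ite_mem, Finset.sum_ite_mem, Finset.univ_inter,
      Finset.univ_inter, ← Finset.mul_sum, Finset.sum_sub_distrib, Finset.sum_const, hBc] at h2
    simp only [mul_sub, Finset.sum_sub_distrib, ← Finset.sum_mul, hsum, nsmul_eq_mul] at h2
    have h3 := hH H hHyp
    nlinarith

theorem mem_basePolytope_iff {M : Matroid α} (hM : IsPaving M) (hE : M.E = Set.univ)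
    {q : ℕ} (hr : M.eRank = ((q + 1 : ℕ) : ℕ∞)) (x : α → ℝ) :
    x ∈ basePolytope M ↔ (∀ i, 0 ≤ x i) ∧ (∀ i, x i ≤ 1) ∧ ∑ i, x i = q + 1 ∧
      ∀ H : Finset α, IsHyperplane M (H : Set α) → ∑ i ∈ H, x i ≤ q := by
  classical
  constructor
  · intro hx
    have hconv : Convex ℝ {x : α → ℝ | (∀ i, 0 ≤ x i) ∧ (∀ i, x i ≤ 1) ∧ ∑ i, x i = q + 1 ∧
        ∀ H : Finset α, IsHyperplane M (H : Set α) → ∑ i ∈ H, x i ≤ q} := by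
      rintro x ⟨hx0, hx1, hxs, hxH⟩ y ⟨hy0, hy1, hys, hyH⟩ a b ha hb hab
      have hs : ∀ S : Finset α, ∑ i ∈ S, (a • x + b • y) i = a * ∑ i ∈ S, x i + b * ∑ i ∈ S, y i :=
        fun S => by simp [Finset.sum_add_distrib, Finset.mul_sum]
      refine ⟨fun i => ?_, fun i => ?_, ?_, fun H hH => ?_⟩
      · have := hx0 i; have := hy0 i
        simp only [Pi.add_apply, Pi.smul_apply, smul_eq_mul]
        positivity
      · simp only [Pi.add_apply, Pi.smul_apply, smul_eq_mul]
        nlinarith [hx1 i, hy1 i]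
      · rw [hs, hxs, hys, ← add_mul, hab, one_mul]
      · rw [hs]
        nlinarith [hxH H hH, hyH H hH]
    refine convexHull_min ?_ hconv hx
    rintro _ ⟨B, hB, rfl⟩
    have hB : M.IsBase B := hB
    have hs : ∀ S : Finset α, ∑ i ∈ S, B.indicator (fun _ => (1 : ℝ)) i
        = ((S.filter (· ∈ B)).card : ℝ) := fun S => by
      simp [Set.indicator_apply]
    have he : ∀ S : Finset α, ((S.filter (· ∈ B)).card : ℕ∞) = ((S : Set α) ∩ B).encard :=
      fun S => by
        rw [← Set.encard_coe_eq_coe_finsetCard]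
        congr 1
        ext i; simp
    refine ⟨fun i => ?_, fun i => ?_, ?_, fun H hH => ?_⟩
    · change 0 ≤ B.indicator (fun _ => (1 : ℝ)) i
      rw [Set.indicator_apply]; split_ifs <;> norm_num
    · change B.indicator (fun _ => (1 : ℝ)) i ≤ 1
      rw [Set.indicator_apply]; split_ifs <;> norm_num
    · have := he Finset.univ
      rw [Finset.coe_univ, Set.univ_inter, hB.encard_eq_eRank, hr] at this
      have h' : (Finset.univ.filter (· ∈ B)).card = q + 1 := by exact_mod_cast this
      change ∑ i, B.indicator (fun _ => (1 : ℝ)) i = _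
      rw [hs, h']
      push_cast; ring
    · have h2 : (((H.filter (· ∈ B)).card : ℕ) : ℕ∞) ≤ q := by
        rw [he, ← (hB.indep.subset Set.inter_subset_right).eRk_eq_encard]
        rw [← hH.eRk_eq hr]
        exact M.eRk_mono Set.inter_subset_left
      change ∑ i ∈ H, B.indicator (fun _ => (1 : ℝ)) i ≤ _
      rw [hs]
      exact_mod_cast h2
  · rintro ⟨h0, h1, hs, hH⟩
    -- A point outside the polytope is strictly separated from it by a functional with weights `w`,
    -- against which the greedy basis gives a contradiction.
    by_contra hx
    obtain ⟨f, u, hf, hu⟩ := geometric_hahn_banach_closed_point (convex_convexHull ℝ _)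
      (Set.Finite.isClosed_convexHull ℝ (Set.toFinite _)) hx
    set w : α → ℝ := fun i => f fun j => if i = j then 1 else 0 with hw
    have hfw : ∀ y : α → ℝ, f y = ∑ i, y i * w i := fun y => by
      simpa using LinearMap.pi_apply_eq_sum_univ (f : (α → ℝ) →ₗ[ℝ] ℝ) y
    obtain ⟨B, hB, hle⟩ := hM.exists_isBase_weight hE hr x w h0 h1 hs hH
    have h2 := hf _ (subset_convexHull ℝ _ ⟨(B : Set α), hB, rfl⟩)
    rw [hfw] at h2 hu
    have h3 : ∑ i, (B : Set α).indicator (fun _ => (1 : ℝ)) i * w i = ∑ i ∈ B, w i := by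
      simp [Set.indicator_apply]
    simp only [h3] at h2
    linarith

/-- The lattice points of the dilates of the base polytope of a paving matroid. -/
theorem intCast_mem_smul_basePolytope_iff {M : Matroid α} (hM : IsPaving M) (hE : M.E = Set.univ)
    {q : ℕ} (hr : M.eRank = ((q + 1 : ℕ) : ℕ∞)) (t : ℕ) (x : α → ℤ) :
    (fun i => (x i : ℝ)) ∈ (t : ℝ) • basePolytope M ↔
      (∀ i, 0 ≤ x i) ∧ (∀ i, x i ≤ t) ∧ ∑ i, x i = t * (q + 1) ∧
      ∀ H : Finset α, IsHyperplane M (H : Set α) → ∑ i ∈ H, x i ≤ t * q := by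
  -- For t = 0 one cannot rescale by t⁻¹; both sides then say x = 0, since the polytope is nonempty.
  rcases Nat.eq_zero_or_pos t with rfl | ht
  · have hne : (basePolytope M).Nonempty := by
      obtain ⟨B, hB⟩ := M.exists_isBase
      exact ⟨_, subset_convexHull ℝ _ ⟨B, hB, rfl⟩⟩
    rw [Nat.cast_zero, Set.zero_smul_set hne, Set.mem_zero]
    constructor
    · intro h
      have h' : ∀ i, x i = 0 := fun i => by simpa using congrFun h i
      simp [h']
    · rintro ⟨h0, h1, -⟩
      funext i
      have : x i = 0 := le_antisymm (by simpa using h1 i) (h0 i)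
      simp [this]
  · have ht' : (0 : ℝ) < t := by exact_mod_cast ht
    rw [Set.mem_smul_set_iff_inv_smul_mem₀ ht'.ne', mem_basePolytope_iff hM hE hr]
    simp only [Pi.smul_apply, smul_eq_mul, ← Finset.mul_sum, inv_mul_le_iff₀ ht',
      inv_mul_eq_iff_eq_mul₀ ht'.ne', mul_one]
    refine and_congr (forall_congr' fun i => ?_) (and_congr (forall_congr' fun i => ?_)
      (and_congr ?_ (forall_congr' fun H => imp_congr_right fun _ => ?_)))
    · rw [mul_nonneg_iff_of_pos_left (inv_pos.mpr ht')]
      exact Int.cast_nonneg_iff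
    all_goals exact_mod_cast Iff.rfl

open Classical in
/-- The Ehrhart function of a paving matroid as a count of points in the cube. -/
theorem ehrhart_basePolytope {M : Matroid α} (hM : IsPaving M) (hE : M.E = Set.univ)
    {q : ℕ} (hr : M.eRank = ((q + 1 : ℕ) : ℕ∞)) (t : ℕ) :
    ehrhart (basePolytope M) t = (Finset.univ.filter fun x : α → Fin (t + 1) =>
      ∑ i, (x i : ℕ) = t * (q + 1) ∧
      ∀ H : Finset α, IsHyperplane M (H : Set α) → ∑ i ∈ H, (x i : ℕ) ≤ t * q).card := by
  set f : (α → Fin (t + 1)) → (α → ℤ) := fun x i => ((x i : ℕ) : ℤ) with hf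
  have hinj : Function.Injective f := by
    intro x y h
    funext i
    have : ((x i : ℕ) : ℤ) = ((y i : ℕ) : ℤ) := congrFun h i
    exact Fin.ext (by exact_mod_cast this)
  rw [ehrhart, ← Set.ncard_coe_finset, ← Set.ncard_image_of_injective _ hinj]
  congr 1
  ext x
  rw [Set.mem_ofPred_eq, intCast_mem_smul_basePolytope_iff hM hE hr]
  simp only [Finset.coe_filter, Finset.mem_univ, true_and, Set.mem_image, Set.mem_ofPred_eq]
  constructor
  · rintro ⟨h0, h1, h2, h3⟩
    lift x to α → ℕ using h0
    refine ⟨fun i => ⟨x i, ?_⟩, ⟨?_, fun H hH => ?_⟩, rfl⟩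
    · have := h1 i
      simp only at this
      omega
    · simp only at h2 ⊢; exact_mod_cast h2
    · have := h3 H hH
      simp only at this ⊢; exact_mod_cast this
  · rintro ⟨y, ⟨h1, h2⟩, rfl⟩
    refine ⟨fun i => by positivity, fun i => ?_, ?_, fun H hH => ?_⟩
    · have := (y i).2
      simp only [hf]; omega
    · simp only [hf]; exact_mod_cast h1
    · have := h2 H hH
      simp only [hf]; exact_mod_cast this

end PavingEhrhart

/-! ### Evaluating the cuts and assembling the formula -/

namespace PavingEhrhart

theorem eval_phiTilde {k p q c : ℕ} (hc : k = q + c) (t : ℚ) :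
    (phiTilde (q + 1) (k + 1) (k + 1 + (p + 1))).eval t = ∑ i ∈ Finset.range (c + 1),
      (-1) ^ i * ((k + 1).choose i : ℚ) * innerSum p k (k - i + t * (c - i)) t := by
  have e : k + 1 - (q + 1) + 1 = c + 1 := by omega
  simp only [phiTilde, e, Polynomial.eval_finsetSum, Polynomial.eval_mul, eval_polyChoose,
    Polynomial.eval_pow, Polynomial.eval_neg, Polynomial.eval_one, Polynomial.eval_natCast,
    Polynomial.eval_sub, Polynomial.eval_add, Polynomial.eval_X, Polynomial.eval_ofNat]
  refine Finset.sum_congr rfl fun i _ => ?_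
  congr 1
  refine Finset.sum_congr rfl fun l _ => ?_
  have e1 : k + 1 + (p + 1) - 2 - l = p + k - l := by omega
  have e2 : k + 1 - 1 - l = k - l := by omega
  rw [e1, e2, hc]
  push_cast
  congr 2
  · congr 1; ring
  · ring

theorem cutCount_of_le_card {β : Type*} [Fintype β] {H : Finset β} {t r n s : ℕ}
    (hn : Fintype.card β = n) (hs : H.card = s) (hr : 1 ≤ r) (hrs : r ≤ s) (hsn : s < n) :
    (cutCount H t r : ℚ) = (((n : ℚ) - s) / ((n - 1)! : ℚ)) *
      (polyChoose (Polynomial.X - 1 + (n : ℚ[X]) - (s : ℚ[X])) (n - s)).eval (t : ℚ) *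
      (phiTilde r s n).eval (t : ℚ) := by
  classical
  obtain ⟨q, rfl⟩ := Nat.exists_eq_add_of_le' hr
  obtain ⟨k, rfl⟩ := Nat.exists_eq_add_of_le' (hr.trans hrs)
  obtain ⟨p, rfl⟩ := Nat.exists_eq_add_of_lt hsn
  obtain ⟨c, hc⟩ := Nat.exists_eq_add_of_le (Nat.succ_le_succ_iff.mp hrs)
  have hHcard : Fintype.card {i // i ∈ H} = k + 1 := by rw [Fintype.card_coe, hs]
  have hHc : Fintype.card {i // i ∉ H} = p + 1 := by
    rw [Fintype.card_subtype_compl, Fintype.card_coe, hs, hn]; omega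
  have hterm : ∀ y ∈ Finset.range t,
      ((boxCount {i // i ∈ H} t (t * (q + 1) - y) * boxCount {i // i ∉ H} t y : ℕ) : ℚ) =
      ∑ i ∈ Finset.range (c + 1), (-1) ^ i * ((k + 1).choose i : ℚ) *
        (((y + p).choose p : ℚ) * ratChoose (k - i + t * (c - i) + y) k) := by
    intro y hy
    have hyt : y < t := Finset.mem_range.mp hy
    -- Reflecting inside `H` turns the total `t * r - y` into `t * c + y` with c = s - r.
    have h1 : t * (q + 1) - y + (t * c + y) = t * Fintype.card {i // i ∈ H} := by
      have e1 : t * (q + 1) = t * q + t := by ring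
      have e2 : t * (q + c + 1) = t * q + t * c + t := by ring
      rw [hHcard, hc, e1, e2]
      omega
    rw [boxCount_compl _ _ _ h1, boxCount_of_le hHc hyt.le, Nat.cast_mul,
      boxCount_eq_ratChoose hHcard (by omega) hyt.le, Finset.sum_mul]
    exact Finset.sum_congr rfl fun i _ => by ring
  rw [cutCount_eq_sum H t _ hr, Nat.cast_sum, Finset.sum_congr rfl hterm, Finset.sum_comm]
  -- The summation identity is applied with `a = k - i + t * (c - i)`, where k = s - 1.
  simp only [← Finset.mul_sum, sum_choose_mul_ratChoose]
  have e0 : k + 1 + p + 1 = k + 1 + (p + 1) := rfl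
  have e1 : k + 1 + (p + 1) - (k + 1) = p + 1 := by omega
  have e2 : k + 1 + (p + 1) - 1 = p + 1 + k := by omega
  rw [e0, e1, e2, eval_phiTilde hc, eval_polyChoose, Finset.mul_sum]
  refine Finset.sum_congr rfl fun i _ => ?_
  simp only [Polynomial.eval_sub, Polynomial.eval_add, Polynomial.eval_X, Polynomial.eval_one,
    Polynomial.eval_natCast]
  push_cast
  have e3 : (t : ℚ) - 1 + (k + 1 + (p + 1)) - (k + 1) = t + p := by ring
  rw [e3]
  ring

theorem cutCount_of_card_lt {β : Type*} [Fintype β] {H : Finset β} {t r : ℕ} (hr : H.card < r) :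
    cutCount H t r = 0 := by
  classical
  rw [cutCount, Finset.card_eq_zero, Finset.filter_eq_empty_iff]
  rintro x - ⟨-, h⟩
  have h1 : ∑ i ∈ H, (x i : ℕ) ≤ H.card • t :=
    Finset.sum_le_card_nsmul _ _ _ fun i _ => Nat.lt_succ_iff.mp (x i).2
  have h2 : t * H.card ≤ t * (r - 1) := Nat.mul_le_mul_left _ (by omega)
  rw [smul_eq_mul, mul_comm] at h1
  omega

section Matroid

theorem ehrhart_of_eRank_eq_zero {α : Type*} {M : Matroid α} (hM : M.eRank = 0) (t : ℕ) :
    ehrhart (basePolytope M) t = 1 := by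
  have hb : {B | M.IsBase B} = {∅} := by
    have h : ∀ B, M.IsBase B → B = ∅ := fun B hB => by
      rw [← Set.encard_eq_zero, hB.encard_eq_eRank, hM]
    obtain ⟨B, hB⟩ := M.exists_isBase
    ext B'
    refine ⟨h B', ?_⟩
    rintro rfl
    exact h B hB ▸ hB
  have hp : basePolytope M = {0} := by
    rw [basePolytope, hb]
    simp
    rfl
  rw [ehrhart, hp, Set.smul_set_singleton, smul_zero, Set.ncard_eq_one]
  refine ⟨0, ?_⟩
  ext x
  simp [funext_iff]

variable {α : Type*} [Fintype α]

open Classical in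
/-- The finite set of hyperplanes of a matroid on a finite type. -/
noncomputable def hyperplanes (M : Matroid α) : Finset (Finset α) :=
  Finset.univ.filter fun H : Finset α => IsHyperplane M (H : Set α)

@[simp] theorem mem_hyperplanes {M : Matroid α} {H : Finset α} :
    H ∈ hyperplanes M ↔ IsHyperplane M (H : Set α) := by
  simp [hyperplanes]

theorem numHyperplanes_eq_card (M : Matroid α) (s : ℕ) :
    numHyperplanes M s = ((hyperplanes M).filter fun H => H.card = s).card := by
  classical
  rw [numHyperplanes, ← Set.ncard_coe_finset,
    ← Set.ncard_image_of_injective _ (Finset.coe_injective (α := α))]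
  congr 1
  ext H
  simp only [Finset.coe_filter, mem_hyperplanes, Set.mem_image, Set.mem_ofPred_eq]
  constructor
  · rintro ⟨h1, h2⟩
    refine ⟨H.toFinset, ⟨by simpa using h1, ?_⟩, Set.coe_toFinset H⟩
    rw [← Set.coe_toFinset H, Set.encard_coe_eq_coe_finsetCard] at h2
    exact_mod_cast h2
  · rintro ⟨F, ⟨h1, h2⟩, rfl⟩
    exact ⟨h1, by rw [Set.encard_coe_eq_coe_finsetCard, h2]⟩

theorem IsHyperplane.card_lt {M : Matroid α} (hE : M.E = Set.univ) {q : ℕ}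
    (hr : M.eRank = ((q + 1 : ℕ) : ℕ∞)) {H : Finset α} (hH : IsHyperplane M (H : Set α)) :
    H.card < Fintype.card α := by
  rw [Finset.card_lt_iff_ne_univ]
  rintro rfl
  have h := hH.eRk_eq hr
  rw [Finset.coe_univ, ← hE, Matroid.eRk_ground, hr] at h
  have : q + 1 = q := by exact_mod_cast h
  omega

/-- Every lattice point of the dilated hypersimplex violates at most one hyperplane inequality. -/
theorem ehrhart_add_sum_cutCount {M : Matroid α} (hM : IsPaving M) (hE : M.E = Set.univ)
    {q : ℕ} (hr : M.eRank = ((q + 1 : ℕ) : ℕ∞)) (t : ℕ) :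
    ehrhart (basePolytope M) t +
      ∑ H ∈ hyperplanes M, cutCount H t (q + 1) =
      boxCount α t (t * (q + 1)) := by
  classical
  rw [ehrhart_basePolytope hM hE hr]
  simp only [cutCount]
  rw [← Finset.card_biUnion, ← Finset.card_union_of_disjoint, boxCount]
  · congr 1
    ext x
    simp only [Finset.mem_union, Finset.mem_filter, Finset.mem_univ, true_and,
      Finset.mem_biUnion, mem_hyperplanes, Nat.add_sub_cancel]
    constructor
    · rintro (⟨h, -⟩ | ⟨H, -, h, -⟩) <;> exact h
    · intro h
      by_cases h' : ∀ H : Finset α, IsHyperplane M (H : Set α) → ∑ i ∈ H, (x i : ℕ) ≤ t * q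
      · exact Or.inl ⟨h, h'⟩
      · push Not at h'
        obtain ⟨H, hH, hlt⟩ := h'
        exact Or.inr ⟨H, hH, h, hlt⟩
  · rw [Finset.disjoint_left]
    intro x hx hx'
    simp only [Finset.mem_filter, Finset.mem_univ, true_and, Finset.mem_biUnion,
      Nat.add_sub_cancel] at hx hx'
    obtain ⟨H, hH, -, hlt⟩ := hx'
    exact absurd (hx.2 H (mem_hyperplanes.mp hH)) (not_le.mpr hlt)
  · intro H hH H' hH' hne
    rw [Function.onFun, Finset.disjoint_left]
    intro x hx hx'
    rw [Finset.mem_coe, mem_hyperplanes] at hH hH'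
    simp only [Finset.mem_filter, Finset.mem_univ, true_and, Nat.add_sub_cancel] at hx hx'
    have hcard := hM.card_inter_lt hE hr hH hH' hne
    have h1 : ∑ i ∈ H ∩ H', (x i : ℕ) ≤ (H ∩ H').card • t :=
      Finset.sum_le_card_nsmul _ _ _ fun i _ => Nat.lt_succ_iff.mp (x i).2
    have h2 := Finset.sum_union_inter (s₁ := H) (s₂ := H') (f := fun i => (x i : ℕ))
    have h3 : ∑ i ∈ H ∪ H', (x i : ℕ) ≤ ∑ i, (x i : ℕ) :=
      Finset.sum_le_sum_of_subset (Finset.subset_univ _)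
    -- Two violations would give x(H) + x(H') > 2tq, whereas x(H ∪ H') ≤ t(q + 1) and x(H ∩ H') ≤
    -- t(q - 1).
    have h4 : (H ∩ H').card • t + t ≤ t * q := by
      rw [smul_eq_mul, ← Nat.succ_mul, mul_comm]
      exact Nat.mul_le_mul_left _ hcard
    have h5 : t * (q + 1) = t * q + t := by ring
    omega

theorem sum_cutCount {M : Matroid α} (hE : M.E = Set.univ) {q n : ℕ}
    (hn : Fintype.card α = n) (hr : M.eRank = ((q + 1 : ℕ) : ℕ∞)) (t : ℕ) :
    ((∑ H ∈ hyperplanes M, cutCount H t (q + 1) : ℕ) : ℚ) =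
      (∑ s ∈ Finset.Ico (q + 1) n,
        Polynomial.C ((numHyperplanes M s : ℚ) * (((n : ℚ) - (s : ℚ)) / ((n - 1)! : ℚ))) *
          polyChoose (Polynomial.X - 1 + (n : ℚ[X]) - (s : ℚ[X])) (n - s) *
          phiTilde (q + 1) s n).eval (t : ℚ) := by
  classical
  have hmaps : ∀ H ∈ (hyperplanes M).filter fun H => q + 1 ≤ H.card,
      H.card ∈ Finset.Ico (q + 1) n := by
    intro H hH
    rw [Finset.mem_filter, mem_hyperplanes] at hH
    exact Finset.mem_Ico.mpr ⟨hH.2, hn ▸ hH.1.card_lt hE hr⟩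
  have hres : ∑ H ∈ hyperplanes M, cutCount H t (q + 1) =
      ∑ H ∈ (hyperplanes M).filter fun H => q + 1 ≤ H.card, cutCount H t (q + 1) := by
    symm
    refine Finset.sum_subset (Finset.filter_subset _ _) fun H hH hH' => cutCount_of_card_lt ?_
    rw [Finset.mem_filter, not_and, not_le] at hH'
    exact hH' hH
  rw [hres, ← Finset.sum_fiberwise_of_maps_to hmaps, Polynomial.eval_finsetSum, Nat.cast_sum]
  refine Finset.sum_congr rfl fun s hs => ?_
  rw [Finset.mem_Ico] at hs
  rw [Finset.filter_filter, Nat.cast_sum]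
  have hset : ((hyperplanes M).filter fun H => q + 1 ≤ H.card ∧ H.card = s) =
      (hyperplanes M).filter fun H => H.card = s :=
    Finset.filter_congr fun H _ => ⟨fun h => h.2, fun h => ⟨h ▸ hs.1, h⟩⟩
  rw [hset, Finset.sum_congr rfl fun H hH => cutCount_of_le_card hn (Finset.mem_filter.mp hH).2
    (Nat.succ_pos q) hs.1 hs.2, Finset.sum_const, numHyperplanes_eq_card]
  simp only [Polynomial.eval_mul, Polynomial.eval_C, nsmul_eq_mul]
  ring

theorem uniform_eRank {r : ℕ} (hr : r ≤ Fintype.card α) : (uniform α r).eRank = r := by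
  obtain ⟨B, hB⟩ := (uniform α r).exists_isBase
  rw [← hB.encard_eq_eRank, (uniform_isBase_iff hr).mp hB]

theorem uniform_isPaving {r : ℕ} (hr : r ≤ Fintype.card α) : IsPaving (uniform α r) := by
  intro C hC
  have := hC.not_indep
  rw [uniform_indep_iff, not_le] at this
  rw [uniform_eRank hr]
  exact this.le

/-- The uniform matroid is itself paving, and its hyperplanes have at most q elements, so nothing is
cut off. -/
theorem ehrhart_uniform {q : ℕ} (hq : q + 1 ≤ Fintype.card α) (t : ℕ) :
    ehrhart (basePolytope (uniform α (q + 1))) t = boxCount α t (t * (q + 1)) := by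
  classical
  rw [← ehrhart_add_sum_cutCount (uniform_isPaving hq) rfl (uniform_eRank hq), eq_comm,
    Nat.add_eq_left]
  refine Finset.sum_eq_zero fun H hH => cutCount_of_card_lt ?_
  have hH := (mem_hyperplanes.mp hH).eRk_eq (uniform_eRank hq)
  by_contra! h
  obtain ⟨I, hI, hIc⟩ := Finset.exists_subset_card_eq h
  have hIe : (I : Set α).encard = ((q + 1 : ℕ) : ℕ∞) := by
    rw [Set.encard_coe_eq_coe_finsetCard, hIc]
  have hi : (uniform α (q + 1)).Indep (I : Set α) := uniform_indep_iff.mpr hIe.le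
  have h1 := hi.encard_le_eRk_of_subset (Finset.coe_subset.mpr hI)
  rw [hH, hIe] at h1
  have : q + 1 ≤ q := by exact_mod_cast h1
  omega

/-- The Ehrhart polynomial of the hypersimplex. -/
theorem exists_poly_boxCount {q n : ℕ} (hn : Fintype.card α = n) (hq : q + 1 ≤ n) :
    ∃ p : ℚ[X], ∀ t : ℕ, p.eval (t : ℚ) = boxCount α t (t * (q + 1)) := by
  obtain ⟨c, rfl⟩ := Nat.exists_eq_add_of_le' hq
  refine ⟨∑ i ∈ Finset.range (c + 1), Polynomial.C ((-1) ^ i * ((c + q + 1).choose i : ℚ)) *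
    polyChoose (Polynomial.C (((c + q : ℕ) : ℚ) - i) + Polynomial.X * Polynomial.C ((c : ℚ) - i))
      (c + q), fun t => ?_⟩
  have h1 : t * (q + 1) + (t * c + 0) = t * Fintype.card α := by rw [hn]; ring
  rw [boxCount_compl _ _ _ h1, boxCount_eq_ratChoose (k := c + q) hn (by omega) (Nat.zero_le _),
    Polynomial.eval_finsetSum]
  refine Finset.sum_congr rfl fun i _ => ?_
  simp [eval_polyChoose]

end Matroid

end PavingEhrhart

theorem mainTheorem2 {α : Type*} [Fintype α] (M : Matroid α) (hE : M.E = Set.univ)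
    (n r : ℕ) (hn : Fintype.card α = n) (hr : M.eRank = (r : ℕ∞))
    (hM : PavingEhrhart.IsPaving M) :
    ∃ ehrM ehrU : ℚ[X],
      PavingEhrhart.IsEhrhartPolynomial (PavingEhrhart.basePolytope M) ehrM ∧
      PavingEhrhart.IsEhrhartPolynomial
        (PavingEhrhart.basePolytope (PavingEhrhart.uniform (Fin n) r)) ehrU ∧
      ehrM = ehrU - ∑ s ∈ Finset.Ico r n,
        Polynomial.C ((PavingEhrhart.numHyperplanes M s : ℚ) *
            (((n : ℚ) - (s : ℚ)) / ((n - 1)! : ℚ))) *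
          PavingEhrhart.polyChoose (Polynomial.X - 1 + (n : ℚ[X]) - (s : ℚ[X])) (n - s) *
          PavingEhrhart.phiTilde r s n := by
  classical
  have hrn : r ≤ n := by
    have := M.eRank_le_encard_ground
    rw [hr, hE, Set.encard_univ, ENat.card_eq_coe_fintype_card, hn] at this
    exact_mod_cast this
  have hrn' : r ≤ Fintype.card (Fin n) := by rwa [Fintype.card_fin]
  cases r with
  | zero =>
    -- In rank 0 no set satisfies `eRk H + 1 = 0`, so the truncated subtractions in `phiTilde` are
    -- multiplied by zero.
    have h0 : ∀ s, PavingEhrhart.numHyperplanes M s = 0 := fun s => by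
      have : {H : Set α | PavingEhrhart.IsHyperplane M H ∧ H.encard = s} = ∅ := by
        ext H
        simp [PavingEhrhart.IsHyperplane, hr]
      rw [PavingEhrhart.numHyperplanes, this, Set.ncard_empty]
    refine ⟨1, 1, fun t => ?_, fun t => ?_, by simp [h0]⟩
    · rw [PavingEhrhart.ehrhart_of_eRank_eq_zero (by simpa using hr)]; simp
    · rw [PavingEhrhart.ehrhart_of_eRank_eq_zero
        (by simpa using PavingEhrhart.uniform_eRank hrn')]; simp
  | succ q =>
    obtain ⟨p, hp⟩ := PavingEhrhart.exists_poly_boxCount (α := Fin n) (Fintype.card_fin n) hrn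
    refine ⟨_, p, fun t => ?_, fun t => ?_, rfl⟩
    · have h1 := PavingEhrhart.ehrhart_add_sum_cutCount hM hE hr t
      rw [PavingEhrhart.boxCount_congr (Fintype.equivFinOfCardEq hn)] at h1
      rw [Polynomial.eval_sub, ← PavingEhrhart.sum_cutCount hE hn hr t, hp, ← h1, Nat.cast_add,
        add_sub_cancel_right]
    · rw [hp, PavingEhrhart.ehrhart_uniform hrn']
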